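/- Let $N$ be a lattice of rank $n$ (a free abelian group of rank $n$) with dual lattice $M=\mathrm{Hom}(N,\mathbb Z)$, and let $\Delta$ be a fan in $N$: a finite collection of rational polyhedral convex cones in $N_{\mathbb R}=N\otimes\mathbb R$, none of which contains a nonzero linear subspace, such that every face of a cone in $\Delta$ is in $\Delta$ and the intersection of any two cones in $\Delta$ is a face of each. For $\sigma\in\Delta$ let $A_\sigma$ be the monoid of all $m\in M$ that are nonnegative on $\sigma$, and let $X=X_\Delta$ be the toric variety of $\Delta$ with its $\mathbb F_1$-structure given by the monoids $A_\sigma$; thus $X_{\mathbb Z}$ is the scheme obtained by gluing the affine schemes $\mathrm{Spec}\,\mathbb Z[A_\sigma]$, $\sigma\in\Delta$, along the open immersions $\mathrm{Spec}\,\mathbb Z[A_\tau]\hookrightarrow\mathrm{Spec}\,\mathbb Z[A_\sigma]$ for $\tau$ a face of $\sigma$. A polynomial $P\in\mathbb Z[x]$ is called a zeta polynomial of $X$ if there is an integer $e\ge 1$ such that $\#X_{\mathbb Z}(\mathbb F_q)=P(q)$ for every prime power $q$ with $\gcd(q-1,e)=1$. If $X$ has a unique zeta polynomial $P(x)=a_0+a_1x+\cdots+a_dx^d$,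 then the $\mathbb F_1$-zeta function of $X$ is the rational function $\zeta_X(s)=s^{a_0}(s-1)^{a_1}\cdots(s-d)^{a_d}$. For $j=0,\dots,n$ let $f_j$ be the number of $j$-dimensional cones in $\Delta$, and set $$c_j=\sum_{k=j}^n f_{n-k}\,(-1)^{k+j}\binom{k}{j}.$$ Then $X$ has exactly one zeta polynomial, namely $$\sum_{k=0}^n f_k\,(x-1)^{n-k},$$ and the $\mathbb F_1$-zeta function of $X$ is $$\zeta_X(s)=s^{c_0}(s-1)^{c_1}\cdots(s-n)^{c_n}.$$ -/

import Mathlib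

open scoped TensorProduct
open CategoryTheory CategoryTheory.Limits AlgebraicGeometry

namespace ToricF1

universe u

noncomputable section

section Cones

variable {N : Type u} [AddCommGroup N]

/-- `σ` is a rational polyhedral cone in `N_ℝ = ℝ ⊗ N`: it is generated, as a convex cone, by
finitely many vectors of the lattice `N`. -/
def IsRationalPolyhedral (σ : PointedCone ℝ (ℝ ⊗[ℤ] N)) : Prop :=
  ∃ S : Finset N, σ = PointedCone.hull ℝ ((fun v : N => (1 : ℝ) ⊗ₜ[ℤ] v) '' (S : Set N))

/-- `σ` is proper: it contains no nonzero linear subspace. For a convex cone this says that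
`x` and `-x` both lie in `σ` only for `x = 0`. -/
def IsProper (σ : PointedCone ℝ (ℝ ⊗[ℤ] N)) : Prop :=
  ∀ x ∈ σ, -x ∈ σ → x = 0

/-- `τ` is a face of `σ`: the intersection of `σ` with the zero set of a real linear form
which is nonnegative on `σ`. -/
def IsFace (τ σ : PointedCone ℝ (ℝ ⊗[ℤ] N)) : Prop :=
  ∃ u : Module.Dual ℝ (ℝ ⊗[ℤ] N), (∀ x ∈ σ, 0 ≤ u x) ∧ ∀ x, x ∈ τ ↔ x ∈ σ ∧ u x = 0

/-- The dimension of a cone: the dimension of the real vector space it spans. -/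
def coneDim (σ : PointedCone ℝ (ℝ ⊗[ℤ] N)) : ℕ :=
  Module.finrank ℝ (Submodule.span ℝ (σ : Set (ℝ ⊗[ℤ] N)))

/-- The monoid `A_σ = σ^∨ ∩ M`, where `M = Hom(N, ℤ)` is the dual lattice and `σ^∨` is the
dual cone: all `m ∈ M` whose real extension `N_ℝ → ℝ` is nonnegative on `σ`. -/
def dualMonoid (σ : PointedCone ℝ (ℝ ⊗[ℤ] N)) : AddSubmonoid (Module.Dual ℤ N) where
  carrier := {m | ∀ x ∈ σ, 0 ≤ m.baseChange ℝ x}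
  zero_mem' := fun x _ => by simp
  add_mem' := fun {a b} ha hb x hx => by
    rw [map_add, LinearMap.add_apply]
    exact add_nonneg (ha x hx) (hb x hx)

theorem mem_dualMonoid {σ : PointedCone ℝ (ℝ ⊗[ℤ] N)} {m : Module.Dual ℤ N} :
    m ∈ dualMonoid σ ↔ ∀ x ∈ σ, 0 ≤ m.baseChange ℝ x := Iff.rfl

theorem dualMonoid_anti {τ σ : PointedCone ℝ (ℝ ⊗[ℤ] N)} (h : τ ≤ σ) :
    dualMonoid σ ≤ dualMonoid τ := fun _ hm x hx => hm x (h hx)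

end Cones

/-- A fan in the lattice `N`: a finite collection of proper rational polyhedral cones in `N_ℝ`,
containing every face of each of its members, and such that two of its members always meet in
a common face. -/
structure Fan (N : Type u) [AddCommGroup N] where
  cones : Set (PointedCone ℝ (ℝ ⊗[ℤ] N))
  finite : cones.Finite
  rational : ∀ σ ∈ cones, IsRationalPolyhedral σ
  proper : ∀ σ ∈ cones, IsProper σ
  face_mem : ∀ σ ∈ cones, ∀ τ, IsFace τ σ → τ ∈ cones
  inter_face : ∀ σ ∈ cones, ∀ τ ∈ cones, IsFace (σ ⊓ τ) σ ∧ IsFace (σ ⊓ τ) τ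

/-- The number of `j`-dimensional cones of the fan. -/
def Fan.numCones {N : Type u} [AddCommGroup N] (Δ : Fan N) (j : ℕ) : ℕ :=
  Set.ncard {σ | σ ∈ Δ.cones ∧ coneDim σ = j}

section Rings

variable {N : Type u} [AddCommGroup N] (R : Type) [CommRing R]

/-- For `τ ⊆ σ`, the ring homomorphism `R[A_σ] → R[A_τ]` induced by `A_σ ⊆ A_τ`. -/
def restrict {τ σ : PointedCone ℝ (ℝ ⊗[ℤ] N)} (h : τ ≤ σ) :
    AddMonoidAlgebra R (dualMonoid σ) →+* AddMonoidAlgebra R (dualMonoid τ) :=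
  AddMonoidAlgebra.mapDomainRingHom R (AddSubmonoid.inclusion (dualMonoid_anti h))

theorem restrict_refl (σ : PointedCone ℝ (ℝ ⊗[ℤ] N)) :
    restrict R (le_refl σ) = RingHom.id _ :=
  AddMonoidAlgebra.mapDomainRingHom_id

theorem restrict_comp {ρ τ σ : PointedCone ℝ (ℝ ⊗[ℤ] N)} (h : ρ ≤ τ) (h' : τ ≤ σ) :
    (restrict R h).comp (restrict R h') = restrict R (h.trans h') :=
  (AddMonoidAlgebra.mapDomainRingHom_comp _ _).symm

/-- The diagram of affine charts `U_σ = Spec R[A_σ]`, `σ ∈ Δ`, with a transition map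
`U_τ ⟶ U_σ` whenever `τ ⊆ σ` (equivalently, for cones of a fan, whenever `τ` is a face of
`σ`). -/
def Fan.chartDiagram (Δ : Fan N) : Δ.cones ⥤ Scheme.{u} where
  obj σ := Spec (CommRingCat.of (AddMonoidAlgebra R (dualMonoid σ.1)))
  map {τ σ} f := Spec.map (CommRingCat.ofHom (restrict R (leOfHom f)))
  map_id σ := by
    rw [restrict_refl]
    exact Spec.map_id _
  map_comp {ρ τ σ} f g := by
    rw [← Spec.map_comp, ← CommRingCat.ofHom_comp, restrict_comp]

end Rings

section Gluing

variable {N : Type u} [AddCommGroup N]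

theorem hull_nonneg {S : Finset N} {m : Module.Dual ℤ N} (h : ∀ v ∈ S, 0 ≤ m v) :
    m ∈ dualMonoid (PointedCone.hull ℝ ((fun v : N => (1 : ℝ) ⊗ₜ[ℤ] v) '' (S : Set N))) := by
  intro x hx
  induction hx using Submodule.span_induction with
  | mem x hx =>
    obtain ⟨v, hv, rfl⟩ := hx
    simpa using h v hv
  | zero => simp
  | add x y _ _ hx hy => rw [map_add]; exact add_nonneg hx hy
  | smul a x _ hx =>
    have : (m.baseChange ℝ) (a • x) = (a : ℝ) * m.baseChange ℝ x := by
      rw [← smul_eq_mul, ← map_smul]; rfl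
    rw [this]; exact mul_nonneg a.2 hx

/-- A nonnegative real form on finitely many lattice vectors can be replaced by an integral one
with the same zeros. -/
theorem exists_integral_form [Module.Finite ℤ N] (L : N →ₗ[ℤ] ℝ) (S : Finset N)
    (hL : ∀ v ∈ S, 0 ≤ L v) :
    ∃ m : Module.Dual ℤ N, ∀ v ∈ S, 0 ≤ m v ∧ (m v = 0 ↔ L v = 0) := by
  classical
  let P := LinearMap.range L
  let b := Module.Free.chooseBasis ℤ P
  let ι := Module.Free.ChooseBasisIndex ℤ P
  let w : ι → Module.Dual ℤ N := fun k => (b.coord k).comp L.rangeRestrict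
  have hw : ∀ v, L v = ∑ k, (b k : ℝ) * (w k v : ℝ) := by
    intro v
    have h := congrArg (Subtype.val) (b.sum_repr (L.rangeRestrict v))
    have h' : L v = ((∑ k, b.repr (L.rangeRestrict v) k • b k : P) : ℝ) := h.symm
    refine h'.trans ?_
    rw [AddSubmonoidClass.coe_finsetSum]
    refine Finset.sum_congr rfl fun k _ => ?_
    rw [SetLike.val_smul, zsmul_eq_mul, mul_comm]
    rfl
  have hw0 : ∀ v, L v = 0 → ∀ k, w k v = 0 := by
    intro v hv k
    have : L.rangeRestrict v = 0 := Subtype.ext hv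
    simp [w, this]
  let U : Set (ι → ℝ) := {c | ∀ v ∈ S, L v ≠ 0 → 0 < ∑ k, c k * (w k v : ℝ)}
  have hU : IsOpen U := by
    have : U = ⋂ v ∈ S, {c | L v ≠ 0 → 0 < ∑ k, c k * (w k v : ℝ)} := by
      ext c; simp [U]
    rw [this]
    refine isOpen_biInter_finset fun v _ => ?_
    by_cases h : L v = 0
    · simp [h]
    · simp only [ne_eq, h, not_false_eq_true, forall_const]
      exact isOpen_lt continuous_const (by fun_prop)
  have hUne : U.Nonempty := by
    refine ⟨fun k => (b k : ℝ), fun v hv h => ?_⟩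
    rw [← hw]
    exact lt_of_le_of_ne (hL v hv) (Ne.symm h)
  have hd : DenseRange (Pi.map (fun (_ : ι) (q : ℚ) => (q : ℝ))) :=
    DenseRange.piMap fun _ => Rat.denseRange_cast
  obtain ⟨q, hq⟩ := hd.exists_mem_open hU hUne
  let D : ℕ := ∏ k, (q k).den
  have hD : 0 < D := Finset.prod_pos fun k _ => (q k).den_pos
  have ha : ∀ k, ∃ a : ℤ, (a : ℝ) = D * (q k : ℝ) := by
    intro k
    obtain ⟨e, he⟩ : (q k).den ∣ D := Finset.dvd_prod_of_mem _ (Finset.mem_univ k)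
    refine ⟨e * (q k).num, ?_⟩
    have h2 : ((q k).num : ℝ) = (q k).den * (q k : ℝ) := by
      have := Rat.den_mul_eq_num (q k)
      exact_mod_cast this.symm
    rw [he]; push_cast; rw [h2]; ring
  choose a ha using ha
  have hm : ∀ v, (((∑ k, a k • w k) v : ℤ) : ℝ) = D * ∑ k, (q k : ℝ) * (w k v : ℝ) := by
    intro v
    simp only [LinearMap.sum_apply, LinearMap.smul_apply, smul_eq_mul, Int.cast_sum,
      Int.cast_mul, ha, Finset.mul_sum, mul_assoc]
  refine ⟨∑ k, a k • w k, fun v hv => ?_⟩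
  by_cases h : L v = 0
  · have : (∑ k, a k • w k) v = 0 := by simp [hw0 v h]
    simp [this, h]
  · have h1 : 0 < ((∑ k, a k • w k) v) := by
      have h2 : (0 : ℝ) < (((∑ k, a k • w k) v : ℤ) : ℝ) := by
        rw [hm]; exact mul_pos (by exact_mod_cast hD) (hq v hv h)
      exact_mod_cast h2
    exact ⟨h1.le, iff_of_false h1.ne' h⟩

/-- A face of a rational polyhedral cone is cut out by an element of `A_σ`. -/
theorem IsFace.exists_form [Module.Finite ℤ N] {τ σ : PointedCone ℝ (ℝ ⊗[ℤ] N)}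
    (hσ : IsRationalPolyhedral σ) (h : IsFace τ σ) :
    ∃ m ∈ dualMonoid σ, ∀ x, x ∈ τ ↔ x ∈ σ ∧ m.baseChange ℝ x = 0 := by
  obtain ⟨S, rfl⟩ := hσ
  obtain ⟨u, hu, hτ⟩ := h
  let L : N →ₗ[ℤ] ℝ := (u.restrictScalars ℤ).comp (TensorProduct.mk ℤ ℝ N 1)
  have hLv : ∀ v, L v = u ((1 : ℝ) ⊗ₜ[ℤ] v) := fun v => rfl
  obtain ⟨m, hm⟩ := exists_integral_form L S
    (fun v hv => hu _ (Submodule.subset_span ⟨v, hv, rfl⟩))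
  have hmS := hull_nonneg fun v hv => (hm v hv).1
  refine ⟨m, hmS, fun x => ?_⟩
  rw [hτ]
  refine and_congr_right fun hx => ?_
  induction hx using Submodule.span_induction with
  | mem x hx =>
    obtain ⟨v, hv, rfl⟩ := hx
    have := (hm v hv).2
    rw [← hLv, ← this]
    simp
  | zero => simp
  | add x y hx' hy' hx hy =>
    rw [map_add, map_add, add_eq_zero_iff_of_nonneg (hu x hx') (hu y hy'),
      add_eq_zero_iff_of_nonneg (hmS x hx') (hmS y hy'), hx, hy]
  | smul a x _ hx =>
    have h1 : (m.baseChange ℝ) (a • x) = (a : ℝ) * m.baseChange ℝ x := by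
      rw [← smul_eq_mul, ← map_smul]; rfl
    have h2 : u (a • x) = (a : ℝ) * u x := by
      rw [← smul_eq_mul, ← map_smul]; rfl
    rw [h1, h2, mul_eq_zero, mul_eq_zero, hx]

/-- If `τ` is cut out of `σ` by `m ∈ A_σ`, then `A_τ = A_σ + ℕ (-m)`. -/
theorem exists_add_mem {τ σ : PointedCone ℝ (ℝ ⊗[ℤ] N)}
    (hσ : IsRationalPolyhedral σ) {m : Module.Dual ℤ N} (hm : m ∈ dualMonoid σ)
    (hτ : ∀ x, x ∈ τ ↔ x ∈ σ ∧ m.baseChange ℝ x = 0) {w : Module.Dual ℤ N}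
    (hw : w ∈ dualMonoid τ) : ∃ k : ℕ, w + k • m ∈ dualMonoid σ := by
  obtain ⟨S, rfl⟩ := hσ
  refine ⟨∑ v ∈ S, (w v).natAbs, hull_nonneg fun v hv => ?_⟩
  have hv' := Submodule.subset_span (R := {c : ℝ // 0 ≤ c})
    (show (1 : ℝ) ⊗ₜ[ℤ] v ∈ (fun v : N => (1 : ℝ) ⊗ₜ[ℤ] v) '' (S : Set N) from ⟨v, hv, rfl⟩)
  have hmv : 0 ≤ m v := by
    have := hm _ hv'
    simpa using this
  simp only [LinearMap.add_apply, LinearMap.smul_apply, nsmul_eq_mul]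
  rcases hmv.eq_or_lt with h0 | h1
  · have h2 : (1 : ℝ) ⊗ₜ[ℤ] v ∈ τ := (hτ _).2 ⟨hv', by simp [← h0]⟩
    have h3 := hw _ h2
    rw [← h0, mul_zero, add_zero]
    simpa using h3
  · have h4 : (w v).natAbs ≤ ∑ v ∈ S, (w v).natAbs :=
      Finset.single_le_sum (f := fun v => (w v).natAbs) (fun _ _ => Nat.zero_le _) hv
    set K := ∑ v ∈ S, (w v).natAbs
    have h5 : (K : ℤ) ≤ K * m v := le_mul_of_one_le_right (by positivity) h1
    have h6 : -(w v) ≤ K := by omega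
    linarith

theorem neg_mem {τ σ : PointedCone ℝ (ℝ ⊗[ℤ] N)} {m : Module.Dual ℤ N}
    (hτ : ∀ x, x ∈ τ ↔ x ∈ σ ∧ m.baseChange ℝ x = 0) : -m ∈ dualMonoid τ := by
  intro x hx
  rw [map_neg, LinearMap.neg_apply, ((hτ x).1 hx).2, neg_zero]

variable (R : Type) [CommRing R]

theorem restrict_single {τ σ : PointedCone ℝ (ℝ ⊗[ℤ] N)} (h : τ ≤ σ) (m : dualMonoid σ) (r : R) :
    restrict R h (AddMonoidAlgebra.single m r) =
      AddMonoidAlgebra.single (AddSubmonoid.inclusion (dualMonoid_anti h) m) r := by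
  simp [restrict]

theorem restrict_injective {τ σ : PointedCone ℝ (ℝ ⊗[ℤ] N)} (h : τ ≤ σ) :
    Function.Injective (restrict R h) :=
  AddMonoidAlgebra.mapDomain_injective (AddSubmonoid.inclusion_injective _)

/-- If `τ` is cut out of `σ` by `m ∈ A_σ`, then `R[A_τ]` is the localization of `R[A_σ]` at the
monomial of `m`. -/
theorem isLocalization {τ σ : PointedCone ℝ (ℝ ⊗[ℤ] N)} (h : τ ≤ σ)
    (hσ : IsRationalPolyhedral σ) {m : Module.Dual ℤ N} (hm : m ∈ dualMonoid σ)
    (hτ : ∀ x, x ∈ τ ↔ x ∈ σ ∧ m.baseChange ℝ x = 0) :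
    letI := (restrict R h).toAlgebra
    IsLocalization.Away (AddMonoidAlgebra.single (⟨m, hm⟩ : dualMonoid σ) (1 : R))
      (AddMonoidAlgebra R (dualMonoid τ)) := by
  let _ := (restrict R h).toAlgebra
  have halg : ∀ x, algebraMap (AddMonoidAlgebra R (dualMonoid σ))
    (AddMonoidAlgebra R (dualMonoid τ)) x = restrict R h x := fun _ => rfl
  refine IsLocalization.Away.mk _ ?_ ?_ ?_
  · rw [halg, restrict_single]
    refine IsUnit.of_mul_eq_one
      (AddMonoidAlgebra.single (⟨-m, neg_mem hτ⟩ : dualMonoid τ) (1 : R)) ?_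
    rw [AddMonoidAlgebra.single_mul_single, AddMonoidAlgebra.one_def]
    congr 1
    · ext1; simp
    · simp
  · intro x
    induction x using AddMonoidAlgebra.induction_linear with
    | zero => exact ⟨0, 0, by simp⟩
    | add f g hf hg =>
      obtain ⟨n₁, a₁, h₁⟩ := hf
      obtain ⟨n₂, a₂, h₂⟩ := hg
      set s := (AddMonoidAlgebra.single (⟨m, hm⟩ : dualMonoid σ) (1 : R))
      refine ⟨n₁ + n₂, a₁ * s ^ n₂ + a₂ * s ^ n₁, ?_⟩
      rw [map_add, map_mul, map_mul, ← h₁, ← h₂, map_pow, map_pow]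
      ring
    | single w r =>
      obtain ⟨k, hk⟩ := exists_add_mem hσ hm hτ w.2
      refine ⟨k, AddMonoidAlgebra.single ⟨w.1 + k • m, hk⟩ r, ?_⟩
      rw [halg, halg, restrict_single, restrict_single, AddMonoidAlgebra.single_pow,
        AddMonoidAlgebra.single_mul_single]
      congr 1
      simp
  · intro a b hab
    exact ⟨0, by rw [restrict_injective R h hab]⟩

theorem isOpenImmersion_of_face [Module.Finite ℤ N] {τ σ : PointedCone ℝ (ℝ ⊗[ℤ] N)}
    (h : τ ≤ σ) (hσ : IsRationalPolyhedral σ) (hf : IsFace τ σ) :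
    IsOpenImmersion (Spec.map (CommRingCat.ofHom (restrict R h))) := by
  obtain ⟨m, hm, hτ⟩ := hf.exists_form hσ
  let _ := (restrict R h).toAlgebra
  have := isLocalization R h hσ hm hτ
  exact IsOpenImmersion.of_isLocalization
    (AddMonoidAlgebra.single (⟨m, hm⟩ : dualMonoid σ) (1 : R))

theorem mem_range_iff {τ σ : PointedCone ℝ (ℝ ⊗[ℤ] N)} (h : τ ≤ σ)
    (hσ : IsRationalPolyhedral σ) {m : Module.Dual ℤ N} (hm : m ∈ dualMonoid σ)
    (hτ : ∀ x, x ∈ τ ↔ x ∈ σ ∧ m.baseChange ℝ x = 0)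
    (p : PrimeSpectrum (AddMonoidAlgebra R (dualMonoid σ))) :
    p ∈ Set.range (PrimeSpectrum.comap (restrict R h)) ↔
      AddMonoidAlgebra.single (⟨m, hm⟩ : dualMonoid σ) (1 : R) ∉ p.asIdeal := by
  let _ := (restrict R h).toAlgebra
  have := isLocalization R h hσ hm hτ
  have h2 := PrimeSpectrum.localization_away_comap_range (AddMonoidAlgebra R (dualMonoid τ))
    (AddMonoidAlgebra.single (⟨m, hm⟩ : dualMonoid σ) (1 : R))
  exact Set.ext_iff.1 h2 p

variable (Δ : Fan N)

theorem Fan.isFace_of_le {τ σ : Δ.cones} (h : τ ≤ σ) : IsFace τ.1 σ.1 := by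
  have := (Δ.inter_face σ.1 σ.2 τ.1 τ.2).1
  rwa [inf_eq_right.2 h] at this

instance Fan.isOpenImmersion_map [Module.Finite ℤ N] {τ σ : Δ.cones} (f : τ ⟶ σ) :
    IsOpenImmersion ((Δ.chartDiagram R).map f) :=
  isOpenImmersion_of_face R (leOfHom f) (Δ.rational σ.1 σ.2) (Δ.isFace_of_le (leOfHom f))

instance Fan.isLocallyDirected [Module.Finite ℤ N] :
    (Δ.chartDiagram R ⋙ Scheme.forget).IsLocallyDirected where
  cond := by
    intro i j k fi fj xi xj hx
    have hk := Δ.rational k.1 k.2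
    obtain ⟨m, hm, hi⟩ := (Δ.isFace_of_le (leOfHom fi)).exists_form hk
    obtain ⟨m', hm', hj⟩ := (Δ.isFace_of_le (leOfHom fj)).exists_form hk
    let l : Δ.cones := ⟨i.1 ⊓ j.1, Δ.face_mem i.1 i.2 _ (Δ.inter_face i.1 i.2 j.1 j.2).1⟩
    have hli : l ≤ i := (inf_le_left : i.1 ⊓ j.1 ≤ i.1)
    have hlj : l ≤ j := (inf_le_right : i.1 ⊓ j.1 ≤ j.1)
    have hlk : l ≤ k := hli.trans (leOfHom fi)
    have hl : ∀ x, x ∈ l.1 ↔ x ∈ k.1 ∧ (m + m').baseChange ℝ x = 0 := by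
      intro x
      change x ∈ i.1 ∧ x ∈ j.1 ↔ _
      rw [hi, hj, map_add, LinearMap.add_apply]
      constructor
      · rintro ⟨⟨h1, h2⟩, -, h3⟩
        exact ⟨h1, by rw [h2, h3, add_zero]⟩
      · rintro ⟨h1, h2⟩
        have := (add_eq_zero_iff_of_nonneg (hm x h1) (hm' x h1)).1 h2
        exact ⟨⟨h1, this.1⟩, h1, this.2⟩
    let p : PrimeSpectrum (AddMonoidAlgebra R (dualMonoid k.1)) :=
      PrimeSpectrum.comap (restrict R (leOfHom fi)) xi
    have hpi : PrimeSpectrum.comap (restrict R (leOfHom fi)) xi = p := rfl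
    have hpj : PrimeSpectrum.comap (restrict R (leOfHom fj)) xj = p := hx.symm
    have h1 := (mem_range_iff R (leOfHom fi) hk hm hi p).1 ⟨xi, hpi⟩
    have h2 := (mem_range_iff R (leOfHom fj) hk hm' hj p).1 ⟨xj, hpj⟩
    have h3 : AddMonoidAlgebra.single (⟨m + m', add_mem hm hm'⟩ : dualMonoid k.1) (1 : R)
        ∉ p.asIdeal := by
      have : AddMonoidAlgebra.single (⟨m + m', add_mem hm hm'⟩ : dualMonoid k.1) (1 : R) =
          AddMonoidAlgebra.single (⟨m, hm⟩ : dualMonoid k.1) (1 : R) *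
          AddMonoidAlgebra.single (⟨m', hm'⟩ : dualMonoid k.1) (1 : R) := by
        rw [AddMonoidAlgebra.single_mul_single, mul_one]; rfl
      rw [this]
      exact fun h => (p.2.mem_or_mem h).elim h1 h2
    obtain ⟨y, hy⟩ := (mem_range_iff R hlk hk (add_mem hm hm') hl p).2 h3
    have key : ∀ (q : Δ.cones) (fq : q ⟶ k) (hlq : l ≤ q)
        (xq : ((Δ.chartDiagram R).obj q)),
        PrimeSpectrum.comap (restrict R (leOfHom fq)) xq = p →
        (Δ.chartDiagram R ⋙ Scheme.forget).map (homOfLE hlq) y = xq := by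
      intro q fq hlq xq hq
      apply ((Δ.chartDiagram R).map fq).isOpenEmbedding.injective
      change PrimeSpectrum.comap (restrict R (leOfHom fq))
        (PrimeSpectrum.comap (restrict R hlq) y) = PrimeSpectrum.comap (restrict R (leOfHom fq)) xq
      rw [hq, ← hy, ← PrimeSpectrum.comap_comp_apply, restrict_comp]
    exact ⟨l, homOfLE hli, homOfLE hlj, y, key i fi hli xi hpi, key j fj hlj xj hpj⟩

/-- The toric scheme `X_Δ` over `R`: the charts `U_σ = Spec R[A_σ]`, `σ ∈ Δ`, glued along the
open immersions `U_τ ⟶ U_σ` for `τ` a face of `σ`. For `R = ℂ` this is the toric variety of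
the fan. Its structure over the field with one element consists of the monoids `A_σ` with their
inclusions, and `R = ℤ` gives the associated scheme over `ℤ`. -/
def Fan.toricScheme [Module.Finite ℤ N] : Scheme.{u} :=
  colimit (Δ.chartDiagram R)

end Gluing

section Zeta

/-- `P` is a zeta polynomial of the scheme `X`: there is a natural number `e ≥ 1` such that
`X` has exactly `P(q)` points over every finite field with `q` elements, `q - 1` prime
to `e`. -/
def IsZetaPolynomial (X : Scheme.{u}) (P : Polynomial ℤ) : Prop :=
  ∃ e : ℕ, 0 < e ∧ ∀ (K : Type u) [Field K] [Finite K], Nat.Coprime (Nat.card K - 1) e →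
    Finite (Spec (CommRingCat.of K) ⟶ X) ∧
      (Nat.card (Spec (CommRingCat.of K) ⟶ X) : ℤ) = P.eval (Nat.card K : ℤ)

/-- The rational function `s^{a₀} (s-1)^{a₁} ⋯ (s-d)^{a_d}` attached to the polynomial
`a₀ + a₁ x + ⋯ + a_d x^d`. -/
def zetaOfPolynomial (P : Polynomial ℤ) : RatFunc ℂ :=
  ∏ j ∈ Finset.range (P.natDegree + 1), (RatFunc.X - RatFunc.C (j : ℂ)) ^ P.coeff j

open Classical in
/-- The zeta function over the field with one element, `ζ_X(s)`, as a rational function of `s`: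
if `X` has a zeta polynomial `a₀ + a₁ x + ⋯ + a_d x^d`, then it is
`s^{a₀} (s-1)^{a₁} ⋯ (s-d)^{a_d}`. Without a zeta polynomial it is not defined, and the
value is `0`, which no such product takes. -/
def f1Zeta (X : Scheme.{u}) : RatFunc ℂ :=
  if h : ∃ P, IsZetaPolynomial X P then zetaOfPolynomial h.choose else 0

end Zeta

end

end ToricF1

/-! The points of a toric scheme over a field `K` decompose into torus orbits, one for each cone. A
`K`-point of the chart of `σ` is a multiplicative map `A_σ → K`. If some monomial `m` outside `σ^⊥`
is nonzero at the point, then the point already lies in the chart of the smaller face of `σ` where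
`m` vanishes. So each point has a smallest chart, and in that chart it is a character of the group
`σ^⊥ ∩ M` extended by zero. This gives the bijection `orbitPoint` from pairs (cone, character) to
`K`-points (`orbitPoint_injective`, `orbitPoint_surjective`).

The group `σ^⊥ ∩ M` is free of rank `n - dim σ` (`finrank_perp_add_coneDim`), so over a field with
`q` elements it has `(q - 1)^(n - dim σ)` characters. Summing over cones gives the zeta polynomial,
valid for every `q`. It is the only one because infinitely many prime powers `q` have `q - 1` prime
to any given `e`. Its coefficients, from the binomial theorem, are the exponents `c_j`. -/

namespace ToricF1

universe u

/-! ### The lattice `σ^⊥ ∩ M`: its rank and its characters. -/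

section Perp

variable {N : Type u} [AddCommGroup N]

/-- The integral forms vanishing on the cone `σ`. -/
def perp (σ : PointedCone ℝ (ℝ ⊗[ℤ] N)) : Submodule ℤ (Module.Dual ℤ N) where
  carrier := {m | ∀ x ∈ σ, m.baseChange ℝ x = 0}
  zero_mem' := fun x _ => by simp
  add_mem' := fun {a b} ha hb x hx => by
    rw [map_add, LinearMap.add_apply, ha x hx, hb x hx, add_zero]
  smul_mem' := fun c m hm x hx => by
    rw [map_zsmul, LinearMap.smul_apply, hm x hx, smul_zero]

theorem perp_le_dualMonoid {σ : PointedCone ℝ (ℝ ⊗[ℤ] N)} {m : Module.Dual ℤ N}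
    (hm : m ∈ perp σ) : m ∈ dualMonoid σ := fun x hx => (hm x hx).ge

/-- Nonnegative numbers sum to zero only if both are zero. So `σ^⊥ ∩ M` is a face of the monoid
`A_σ`, which is what makes extension of characters by zero multiplicative. -/
theorem add_mem_perp_iff {σ : PointedCone ℝ (ℝ ⊗[ℤ] N)} {a b : Module.Dual ℤ N}
    (ha : a ∈ dualMonoid σ) (hb : b ∈ dualMonoid σ) :
    a + b ∈ perp σ ↔ a ∈ perp σ ∧ b ∈ perp σ := by
  refine ⟨fun h => ?_, fun h => add_mem h.1 h.2⟩
  have key : ∀ x ∈ σ, a.baseChange ℝ x = 0 ∧ b.baseChange ℝ x = 0 := fun x hx => by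
    have := h x hx
    rwa [map_add, LinearMap.add_apply,
      add_eq_zero_iff_of_nonneg (ha x hx) (hb x hx)] at this
  exact ⟨fun x hx => (key x hx).1, fun x hx => (key x hx).2⟩

theorem mem_perp_hull {S : Set N} {m : Module.Dual ℤ N} :
    m ∈ perp (PointedCone.hull ℝ ((fun v : N => (1 : ℝ) ⊗ₜ[ℤ] v) '' S)) ↔
      ∀ v ∈ Submodule.span ℤ S, m v = 0 := by
  constructor
  · intro h v hv
    induction hv using Submodule.span_induction with
    | mem v hv => simpa using h _ (Submodule.subset_span ⟨v, hv, rfl⟩)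
    | zero => simp
    | add x y _ _ hx hy => rw [map_add, hx, hy, add_zero]
    | smul a x _ hx => rw [map_smul, hx, smul_zero]
  · intro h x hx
    induction hx using Submodule.span_induction with
    | mem x hx =>
      obtain ⟨v, hv, rfl⟩ := hx
      simpa using h v (Submodule.subset_span hv)
    | zero => simp
    | add x y _ _ hx hy => rw [map_add, hx, hy, add_zero]
    | smul a x _ hx =>
      have : (m.baseChange ℝ) (a • x) = (a : ℝ) * m.baseChange ℝ x := by
        rw [← smul_eq_mul, ← map_smul]; rfl
      rw [this, hx, mul_zero]

theorem span_hull (S : Set N) :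
    Submodule.span ℝ ((PointedCone.hull ℝ ((fun v : N => (1 : ℝ) ⊗ₜ[ℤ] v) '' S) :
      PointedCone ℝ (ℝ ⊗[ℤ] N)) : Set (ℝ ⊗[ℤ] N)) =
    LinearMap.range ((Submodule.span ℤ S).subtype.baseChange ℝ) := by
  apply le_antisymm
  · rw [Submodule.span_le]
    intro x hx
    induction hx using Submodule.span_induction with
    | mem x hx =>
      obtain ⟨v, hv, rfl⟩ := hx
      exact ⟨1 ⊗ₜ ⟨v, Submodule.subset_span hv⟩, by simp⟩
    | zero => exact zero_mem _
    | add x y _ _ hx hy => exact add_mem hx hy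
    | smul a x _ hx => exact Submodule.smul_mem _ (a : ℝ) hx
  · rintro _ ⟨y, rfl⟩
    induction y using TensorProduct.induction_on with
    | zero => simp
    | add x y hx hy => rw [map_add]; exact add_mem hx hy
    | tmul r v =>
      obtain ⟨v, hv⟩ := v
      rw [LinearMap.baseChange_tmul, Submodule.subtype_apply, ← mul_one r, ← smul_eq_mul,
        ← TensorProduct.smul_tmul']
      apply Submodule.smul_mem
      induction hv using Submodule.span_induction with
      | mem v hv => exact Submodule.subset_span (Submodule.subset_span ⟨v, hv, rfl⟩)
      | zero => simp
      | add x y _ _ hx hy => rw [TensorProduct.tmul_add]; exact add_mem hx hy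
      | smul a x _ hx => rw [TensorProduct.tmul_smul]; exact zsmul_mem hx a

/-- Flatness of `ℝ` over `ℤ` keeps the inclusion of the lattice spanned by `S` injective after
tensoring, so the real dimension is an integral rank. -/
theorem coneDim_hull [Module.Free ℤ N] [Module.Finite ℤ N] (S : Set N) :
    coneDim (PointedCone.hull ℝ ((fun v : N => (1 : ℝ) ⊗ₜ[ℤ] v) '' S)) =
      Module.finrank ℤ (Submodule.span ℤ S) := by
  rw [coneDim, span_hull, LinearMap.finrank_range_of_inj, Module.finrank_baseChange]
  exact Module.Flat.lTensor_preserves_injective_linearMap _ (Submodule.injective_subtype _)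

/-- Over a principal ideal domain, a submodule of a free module and its annihilator have
complementary ranks. -/
theorem finrank_annihilator_add {R V : Type*} [CommRing R] [IsDomain R] [IsPrincipalIdealRing R]
    [AddCommGroup V] [Module R V] [Module.Free R V] [Module.Finite R V] (L : Submodule R V) :
    Module.finrank R L.dualAnnihilator + Module.finrank R L = Module.finrank R V := by
  let A := L.dualAnnihilator
  have hq := Submodule.finrank_quotient_add_finrank A
  rw [Module.finrank_linearMap, Module.finrank_self, mul_one] at hq
  have hker : A ≤ LinearMap.ker L.dualRestrict := (Submodule.dualRestrict_ker_eq_dualAnnihilator L).ge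
  -- `g` need not be surjective when `L` is not saturated, so ranks are compared in both directions:
  -- `g` is injective, and so is its flip `L → (V^* / A)^*`, because the forms on a free module
  -- separate points.
  let g : (Module.Dual R V ⧸ A) →ₗ[R] Module.Dual R L := A.liftQ L.dualRestrict hker
  have hg : Function.Injective g := by
    rw [← LinearMap.ker_eq_bot]
    exact Submodule.ker_liftQ_eq_bot _ _ _ (Submodule.dualRestrict_ker_eq_dualAnnihilator L).le
  have : Module.IsTorsionFree R (Module.Dual R V ⧸ A) := hg.moduleIsTorsionFree _ (map_smul g)
  have : Module.Free R (Module.Dual R V ⧸ A) := Module.free_of_finite_type_torsion_free'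
  have h1 := LinearMap.finrank_le_finrank_of_injective hg
  have h2 := LinearMap.finrank_le_finrank_of_injective (f := g.flip) (by
    rw [← LinearMap.ker_eq_bot, LinearMap.ker_eq_bot']
    intro v hv
    have : ∀ m : Module.Dual R V, m v = 0 := fun m => LinearMap.congr_fun hv (A.mkQ m)
    exact Subtype.ext ((Module.forall_dual_apply_eq_zero_iff R (v : V)).1 this))
  rw [Module.finrank_linearMap, Module.finrank_self, mul_one] at h1 h2
  have : Module.finrank R (Module.Dual R V ⧸ A) = Module.finrank R L := le_antisymm h1 h2
  change Module.finrank R A + _ = _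
  omega

theorem finrank_perp_add_coneDim [Module.Free ℤ N] [Module.Finite ℤ N]
    {σ : PointedCone ℝ (ℝ ⊗[ℤ] N)} (hσ : IsRationalPolyhedral σ) :
    Module.finrank ℤ (perp σ) + coneDim σ = Module.finrank ℤ N := by
  obtain ⟨S, rfl⟩ := hσ
  have h : perp (PointedCone.hull ℝ ((fun v : N => (1 : ℝ) ⊗ₜ[ℤ] v) '' (S : Set N))) =
      (Submodule.span ℤ (S : Set N)).dualAnnihilator := by
    ext m
    rw [mem_perp_hull, Submodule.mem_dualAnnihilator]
  rw [coneDim_hull, h]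
  convert finrank_annihilator_add (Submodule.span ℤ (S : Set N))

theorem card_characters (A K : Type*) [AddCommGroup A] [Module.Free ℤ A] [Module.Finite ℤ A]
    [Field K] [Finite K] :
    Nat.card (A →ₗ[ℤ] Additive Kˣ) = (Nat.card K - 1) ^ Module.finrank ℤ A := by
  have b := Module.Free.chooseBasis ℤ A
  rw [← Nat.card_congr (b.constr ℤ (M' := Additive Kˣ)).toEquiv, Nat.card_fun,
    Module.finrank_eq_card_chooseBasisIndex, Nat.card_eq_fintype_card (α := Module.Free.ChooseBasisIndex ℤ A),
    ← Nat.card_units]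
  rfl

instance finite_characters (A K : Type*) [AddCommGroup A] [Module.Free ℤ A] [Module.Finite ℤ A]
    [Field K] [Finite K] : Finite (A →ₗ[ℤ] Additive Kˣ) :=
  have : Finite (Additive Kˣ) := inferInstanceAs (Finite Kˣ)
  Finite.of_equiv _ ((Module.Free.chooseBasis ℤ A).constr ℤ (M' := Additive Kˣ)).toEquiv

end Perp

/-! ### Points over a field as characters of the groups `σ^⊥ ∩ M`. -/

section Points

variable {N : Type u} [AddCommGroup N]

/-- The face cut out of `σ` by a form. -/
def faceOf (σ : PointedCone ℝ (ℝ ⊗[ℤ] N)) (m : Module.Dual ℤ N) : PointedCone ℝ (ℝ ⊗[ℤ] N) :=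
  σ ⊓ (LinearMap.ker (m.baseChange ℝ)).restrictScalars {c : ℝ // 0 ≤ c}

theorem mem_faceOf {σ : PointedCone ℝ (ℝ ⊗[ℤ] N)} {m : Module.Dual ℤ N} (x : ℝ ⊗[ℤ] N) :
    x ∈ faceOf σ m ↔ x ∈ σ ∧ m.baseChange ℝ x = 0 := Iff.rfl

theorem isFace_faceOf {σ : PointedCone ℝ (ℝ ⊗[ℤ] N)} {m : Module.Dual ℤ N}
    (hm : m ∈ dualMonoid σ) : IsFace (faceOf σ m) σ :=
  ⟨m.baseChange ℝ, hm, mem_faceOf⟩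

variable (K : Type u) [Field K]

open Classical in
/-- The ring homomorphism `ℤ[A_σ] → K` which extends a character of `σ^⊥ ∩ M` by zero. -/
noncomputable def orbitHom (σ : PointedCone ℝ (ℝ ⊗[ℤ] N)) (χ : perp σ →ₗ[ℤ] Additive Kˣ) :
    AddMonoidAlgebra ℤ (dualMonoid σ) →+* K :=
  (AddMonoidAlgebra.lift ℤ K (dualMonoid σ)
    { toFun a := if h : a.toAdd.1 ∈ perp σ then ((χ ⟨_, h⟩).toMul : K) else 0
      map_one' := by
        have h : (Multiplicative.toAdd (1 : Multiplicative (dualMonoid σ))).1 ∈ perp σ :=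
          zero_mem _
        rw [dif_pos h]
        have : χ ⟨_, h⟩ = 0 := map_zero χ
        rw [this]; rfl
      map_mul' a b := by
        by_cases h : (a * b).toAdd.1 ∈ perp σ
        · have h' := (add_mem_perp_iff a.toAdd.2 b.toAdd.2).1 h
          rw [dif_pos h, dif_pos h'.1, dif_pos h'.2]
          have : χ ⟨_, h⟩ = χ ⟨_, h'.1⟩ + χ ⟨_, h'.2⟩ := by
            rw [← map_add]; rfl
          rw [this, toMul_add, Units.val_mul]
        · rw [dif_neg h]
          have h' : ¬ (_ ∧ _) := fun h' => h ((add_mem_perp_iff a.toAdd.2 b.toAdd.2).2 h')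
          by_cases ha : a.toAdd.1 ∈ perp σ
          · rw [dif_neg (fun hb => h' ⟨ha, hb⟩), mul_zero]
          · rw [dif_neg ha, zero_mul] }).toRingHom

open Classical in
theorem orbitHom_single (σ : PointedCone ℝ (ℝ ⊗[ℤ] N)) (χ : perp σ →ₗ[ℤ] Additive Kˣ)
    (m : dualMonoid σ) : orbitHom K σ χ (AddMonoidAlgebra.single m 1) =
      if h : m.1 ∈ perp σ then ((χ ⟨_, h⟩).toMul : K) else 0 := by
  change AddMonoidAlgebra.lift ℤ K (dualMonoid σ) _ _ = _
  rw [AddMonoidAlgebra.lift_single, one_smul]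
  rfl

variable {K}

theorem orbitHom_injective (σ : PointedCone ℝ (ℝ ⊗[ℤ] N)) :
    Function.Injective (orbitHom K σ) := by
  intro χ χ' h
  ext ⟨m, hm⟩
  have := DFunLike.congr_fun h
    (AddMonoidAlgebra.single (⟨m, perp_le_dualMonoid hm⟩ : dualMonoid σ) 1)
  rw [orbitHom_single, orbitHom_single, dif_pos hm, dif_pos hm] at this
  exact this

/-- A point of `Spec ℤ[A_σ]` at which all monomials outside `σ^⊥` vanish comes from a character
of `σ^⊥ ∩ M`. -/
theorem exists_orbitHom_eq {σ : PointedCone ℝ (ℝ ⊗[ℤ] N)}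
    (ψ : AddMonoidAlgebra ℤ (dualMonoid σ) →+* K)
    (hψ : ∀ m : dualMonoid σ, ψ (AddMonoidAlgebra.single m 1) ≠ 0 → m.1 ∈ perp σ) :
    ∃ χ, orbitHom K σ χ = ψ := by
  let F : Multiplicative (perp σ) →* K :=
    { toFun a := ψ (AddMonoidAlgebra.single ⟨a.toAdd.1, perp_le_dualMonoid a.toAdd.2⟩ 1)
      map_one' := map_one ψ
      map_mul' a b := by
        rw [← map_mul, AddMonoidAlgebra.single_mul_single, one_mul]
        rfl }
  -- The source is a group, so the values of `F` are automatically units.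
  let χ : perp σ →+ Additive Kˣ := F.toHomUnits.toAdditiveRight
  refine ⟨χ.toIntLinearMap, ?_⟩
  refine AddMonoidAlgebra.ringHom_ext (fun r => ?_) fun m => ?_
  · exact RingHom.congr_fun (Subsingleton.elim
      ((orbitHom K σ χ.toIntLinearMap).comp AddMonoidAlgebra.singleZeroRingHom)
      (ψ.comp AddMonoidAlgebra.singleZeroRingHom)) r
  · rw [orbitHom_single]
    split_ifs with h
    · rfl
    · by_contra h'
      exact h (hψ m (Ne.symm h'))

/-! ### Orbit decomposition of the points of the glued scheme, and the count. -/

section Scheme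

variable [Module.Finite ℤ N] (Δ : Fan N)

variable (K) in
/-- The `K`-point of `X_Δ` attached to a cone `σ` and a character of `σ^⊥ ∩ M`. -/
noncomputable def orbitPoint (p : Σ σ : Δ.cones, (perp σ.1 →ₗ[ℤ] Additive Kˣ)) :
    Spec (CommRingCat.of K) ⟶ Δ.toricScheme ℤ :=
  Spec.map (CommRingCat.ofHom (orbitHom K p.1.1 p.2)) ≫ colimit.ι (Δ.chartDiagram ℤ) p.1

/-- An orbit point of `σ` avoids the charts of proper faces: lying in the chart of `τ` means that
the monomial cutting out `τ` is nonzero there, which forces this monomial into `σ^⊥`. -/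
theorem le_of_mem_range {τ σ : Δ.cones} (h : τ ≤ σ) (χ : perp σ.1 →ₗ[ℤ] Additive Kˣ)
    (p : PrimeSpectrum K)
    (hp : PrimeSpectrum.comap (orbitHom K σ.1 χ) p ∈
      Set.range (PrimeSpectrum.comap (restrict ℤ h))) : σ ≤ τ := by
  obtain ⟨m, hm, hτ⟩ := (Δ.isFace_of_le h).exists_form (Δ.rational σ.1 σ.2)
  have h1 := (mem_range_iff ℤ h (Δ.rational σ.1 σ.2) hm hτ _).1 hp
  by_cases hmσ : m ∈ perp σ.1
  · exact fun x hx => (hτ x).2 ⟨hx, hmσ x hx⟩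
  · refine absurd ?_ h1
    change orbitHom K σ.1 χ _ ∈ p.asIdeal
    rw [orbitHom_single, dif_neg hmσ]
    exact zero_mem _

theorem orbitPoint_injective : Function.Injective (orbitPoint K Δ) := by
  rintro ⟨σ, χ⟩ ⟨τ, χ'⟩ h
  let p : PrimeSpectrum K := ⊥
  have hp : colimit.ι (Δ.chartDiagram ℤ) σ (Spec.map (CommRingCat.ofHom (orbitHom K σ.1 χ)) p) =
      colimit.ι (Δ.chartDiagram ℤ) τ (Spec.map (CommRingCat.ofHom (orbitHom K τ.1 χ')) p) :=
    congrArg (fun f : Spec (CommRingCat.of K) ⟶ Δ.toricScheme ℤ => f p) h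
  -- Points of two charts are identified only through a common smaller chart `ρ`; then `σ ≤ ρ ≤ τ`
  -- and `τ ≤ ρ ≤ σ`.
  obtain ⟨ρ, f, g, x, hx, hx'⟩ := (Scheme.IsLocallyDirected.ι_eq_ι_iff _).1 hp
  have h1 := le_of_mem_range Δ (leOfHom f) χ p ⟨x, hx⟩
  have h2 := le_of_mem_range Δ (leOfHom g) χ' p ⟨x, hx'⟩
  obtain rfl : σ = τ := le_antisymm (h1.trans (leOfHom g)) (h2.trans (leOfHom f))
  have h3 : Spec.map (CommRingCat.ofHom (orbitHom K σ.1 χ)) ≫ colimit.ι (Δ.chartDiagram ℤ) σ =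
    Spec.map (CommRingCat.ofHom (orbitHom K σ.1 χ')) ≫ colimit.ι (Δ.chartDiagram ℤ) σ := h
  have : Mono (colimit.ι (Δ.chartDiagram ℤ) σ) := IsOpenImmersion.mono _
  have h4 := Spec.map_injective (this.right_cancellation _ _ h3)
  have h5 : χ = χ' := orbitHom_injective σ.1 (congrArg CommRingCat.Hom.hom h4)
  rw [h5]

theorem orbitPoint_surjective : Function.Surjective (orbitPoint K Δ) := by
  intro g
  let S : Set Δ.cones := {σ | ∃ φ : Spec (CommRingCat.of K) ⟶ (Δ.chartDiagram ℤ).obj σ,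
    φ ≫ colimit.ι (Δ.chartDiagram ℤ) σ = g}
  have : Finite Δ.cones := Δ.finite
  -- `Spec K` has a single point, so `g` factors through any chart containing its image.
  have hS : S.Nonempty := by
    obtain ⟨σ, y, hy⟩ := Scheme.IsLocallyDirected.ι_jointly_surjective (Δ.chartDiagram ℤ)
      (g (⊥ : PrimeSpectrum K))
    refine ⟨σ, IsOpenImmersion.lift (colimit.ι (Δ.chartDiagram ℤ) σ) g ?_,
      IsOpenImmersion.lift_fac _ _ _⟩
    rintro _ ⟨q, rfl⟩
    obtain rfl : q = (⊥ : PrimeSpectrum K) := Subsingleton.elim (α := PrimeSpectrum K) _ _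
    exact ⟨y, hy⟩
  obtain ⟨σ, hσ⟩ := S.toFinite.exists_minimal hS
  obtain ⟨φ, hφ⟩ := hσ.prop
  obtain ⟨ψ, hψ⟩ : ∃ ψ : CommRingCat.of (AddMonoidAlgebra ℤ (dualMonoid σ.1)) ⟶ CommRingCat.of K,
    Spec.map ψ = φ := Spec.map_surjective φ
  obtain ⟨χ, hχ⟩ := exists_orbitHom_eq ψ.hom fun m hm => by
    -- Since `m` is nonzero at the point, `g` also factors through the chart of the face `τ` cut out
    -- by `m`. Minimality of `σ` gives `σ ≤ τ`, hence `m ∈ σ^⊥`.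
    let τ : Δ.cones := ⟨faceOf σ.1 m.1, Δ.face_mem σ.1 σ.2 _ (isFace_faceOf m.2)⟩
    have hτ : τ ≤ σ := (inf_le_left : faceOf σ.1 m.1 ≤ σ.1)
    have hτS : τ ∈ S := by
      have hr : Set.range φ ⊆ Set.range ((Δ.chartDiagram ℤ).map (homOfLE hτ)) := by
        rintro _ ⟨q, rfl⟩
        rw [← hψ]
        refine (mem_range_iff ℤ hτ (Δ.rational σ.1 σ.2) m.2 mem_faceOf _).2 fun h => ?_
        exact q.2.ne_top (Ideal.eq_top_of_isUnit_mem _ h (IsUnit.mk0 _ hm))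
      refine ⟨IsOpenImmersion.lift ((Δ.chartDiagram ℤ).map (homOfLE hτ)) φ hr, ?_⟩
      rw [← colimit.w (Δ.chartDiagram ℤ) (homOfLE hτ), IsOpenImmersion.lift_fac_assoc, hφ]
    exact fun x hx => ((mem_faceOf x).1 (hσ.le_of_le hτS hτ hx)).2
  refine ⟨⟨σ, χ⟩, ?_⟩
  rw [orbitPoint, hχ, ← hφ, ← hψ]
  rfl

/-- The number of points of a toric scheme over a finite field. -/
theorem card_points [Module.Free ℤ N] [Finite K] :
    Finite (Spec (CommRingCat.of K) ⟶ Δ.toricScheme ℤ) ∧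
    Nat.card (Spec (CommRingCat.of K) ⟶ Δ.toricScheme ℤ) =
      ∑ k ∈ Finset.range (Module.finrank ℤ N + 1),
        Δ.numCones k * (Nat.card K - 1) ^ (Module.finrank ℤ N - k) := by
  classical
  have e := Equiv.ofBijective _ ⟨orbitPoint_injective (K := K) Δ, orbitPoint_surjective Δ⟩
  have : Fintype Δ.cones := Δ.finite.fintype
  refine ⟨Finite.of_equiv _ e, ?_⟩
  have hdim : ∀ σ : Δ.cones, Module.finrank ℤ (perp σ.1) + coneDim σ.1 = Module.finrank ℤ N :=
    fun σ => finrank_perp_add_coneDim (Δ.rational σ.1 σ.2)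
  rw [← Nat.card_congr e, Nat.card_sigma, ← Finset.sum_fiberwise_of_maps_to
    (g := fun σ : Δ.cones => coneDim σ.1) (t := Finset.range (Module.finrank ℤ N + 1))
    (fun σ _ => Finset.mem_range.2 (by have := hdim σ; omega))]
  refine Finset.sum_congr rfl fun k _ => ?_
  rw [Finset.sum_congr rfl (g := fun _ => (Nat.card K - 1) ^ (Module.finrank ℤ N - k)),
    Finset.sum_const, smul_eq_mul]
  · congr 1
    rw [Fan.numCones, Set.ncard_eq_toFinset_card _ (Δ.finite.subset fun _ h => h.1)]
    refine Finset.card_bij (fun σ _ => σ.1) (fun σ h => ?_) (fun _ _ _ _ h => Subtype.ext h)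
      fun σ h => ?_
    · simpa using h
    · simp only [Set.Finite.mem_toFinset, Set.mem_ofPred_eq] at h
      exact ⟨⟨σ, h.1⟩, by simpa using h.2, rfl⟩
  · intro σ hσ
    rw [card_characters]
    congr 1
    have h1 := hdim σ
    have h2 := (Finset.mem_filter.1 hσ).2
    omega

end Scheme

end Points

/-! ### Uniqueness of zeta polynomials. -/

section Uniqueness

theorem exists_coprime_two_pow_sub_one {e : ℕ} (he : 0 < e) (B : ℕ) :
    ∃ k, B < 2 ^ k ∧ k ≠ 0 ∧ Nat.Coprime (2 ^ k - 1) e := by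
  obtain ⟨a, o, ho, rfl⟩ := Nat.exists_eq_two_pow_mul_odd he.ne'
  have hφ : 0 < o.totient := Nat.totient_pos.2 ho.pos
  -- By Euler, `2 ^ k ≡ 2` modulo the odd part `o`, hence `2 ^ k - 1 ≡ 1`; without the `+ 1` it
  -- would be `0`. The factor `2 ^ a` is harmless since `2 ^ k - 1` is odd.
  set k := o.totient * B + 1 with hk
  have hBk : B ≤ k := (Nat.le_mul_of_pos_left B hφ).trans (Nat.le_succ _)
  have hpos : 1 ≤ 2 ^ k := Nat.one_le_two_pow
  refine ⟨k, hBk.trans_lt Nat.lt_two_pow_self, Nat.succ_ne_zero _, Nat.Coprime.mul_right ?_ ?_⟩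
  · refine Nat.Coprime.pow_right _ (Nat.coprime_two_right.2 ?_)
    exact Nat.Even.sub_odd hpos (even_two.pow_of_ne_zero (Nat.succ_ne_zero _)) odd_one
  · have h2 : Nat.Coprime 2 o := Nat.coprime_two_left.2 ho
    have h1 : 2 ^ k ≡ 2 [MOD o] := by
      have := ((Nat.ModEq.pow_totient h2).pow B).mul_right 2
      rwa [one_pow, one_mul, ← pow_mul, ← pow_succ] at this
    have h3 : 2 ^ k - 1 ≡ 1 [MOD o] := by
      refine Nat.ModEq.add_right_cancel' 1 ?_
      rwa [Nat.sub_add_cancel hpos]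
    rw [Nat.Coprime, h3.gcd_eq, Nat.gcd_one_left]

/-- There are arbitrarily large finite fields with `q - 1` prime to a given number. -/
theorem exists_field {e : ℕ} (he : 0 < e) (B : ℕ) :
    ∃ (K : Type u) (_ : Field K) (_ : Finite K), B < Nat.card K ∧ Nat.Coprime (Nat.card K - 1) e := by
  obtain ⟨k, hB, hk, h⟩ := exists_coprime_two_pow_sub_one he B
  have hcard : Nat.card (ULift.{u} (GaloisField 2 k)) = 2 ^ k := by
    rw [Nat.card_congr Equiv.ulift, GaloisField.card 2 k hk]
  exact ⟨ULift.{u} (GaloisField 2 k), inferInstance, inferInstance, by rwa [hcard], by rwa [hcard]⟩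

theorem IsZetaPolynomial.unique {X : Scheme.{u}} {P Q : Polynomial ℤ}
    (hP : IsZetaPolynomial X P) (hQ : IsZetaPolynomial X Q) : P = Q := by
  obtain ⟨e, he, hP⟩ := hP
  obtain ⟨e', he', hQ⟩ := hQ
  refine Polynomial.eq_of_infinite_eval_eq P Q (Set.infinite_of_forall_exists_gt fun B => ?_)
  -- The two polynomials may come with different integers `e`, `e'`; coprimality to the product
  -- serves both.
  obtain ⟨K, _, _, hB, hK⟩ := exists_field.{u} (Nat.mul_pos he he') B.natAbs
  refine ⟨Nat.card K, ?_, by omega⟩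
  exact (hP K hK.coprime_mul_right_right).2.symm.trans (hQ K hK.coprime_mul_left_right).2

theorem IsZetaPolynomial.f1Zeta_eq {X : Scheme.{u}} {P : Polynomial ℤ}
    (hP : IsZetaPolynomial X P) : f1Zeta X = zetaOfPolynomial P := by
  have h : ∃ P, IsZetaPolynomial X P := ⟨P, hP⟩
  rw [f1Zeta, dif_pos h, h.choose_spec.unique hP]

/-- The degree can be smaller than `n`, as for the empty fan in positive rank; the additional
factors have exponent `0`. -/
theorem zetaOfPolynomial_eq_prod {P : Polynomial ℤ} {n : ℕ} (hP : P.natDegree ≤ n) :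
    zetaOfPolynomial P =
      ∏ j ∈ Finset.range (n + 1), (RatFunc.X - RatFunc.C (j : ℂ)) ^ P.coeff j := by
  refine Finset.prod_subset (Finset.range_mono (by omega)) fun j _ hj => ?_
  rw [Polynomial.coeff_eq_zero_of_natDegree_lt (by simpa using hj), zpow_zero]

end Uniqueness

/-! ### Coefficients of the face polynomial. -/

section FacePolynomial

open Polynomial

/-- The polynomial `∑ f_k (x - 1)^(n - k)`. -/
noncomputable def facePolynomial (f : ℕ → ℕ) (n : ℕ) : ℤ[X] :=
  ∑ k ∈ Finset.range (n + 1), C (f k : ℤ) * (X - 1) ^ (n - k)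

theorem natDegree_facePolynomial_le (f : ℕ → ℕ) (n : ℕ) : (facePolynomial f n).natDegree ≤ n := by
  refine natDegree_sum_le_of_forall_le _ _ fun k _ => (natDegree_C_mul_le _ _).trans ?_
  rw [← C_1, natDegree_pow, natDegree_X_sub_C, mul_one]
  exact Nat.sub_le _ _

theorem coeff_X_sub_one_pow (k j : ℕ) :
    ((X - 1 : ℤ[X]) ^ k).coeff j = if j ≤ k then (-1) ^ (k + j) * (k.choose j : ℤ) else 0 := by
  have h : (X - 1 : ℤ[X]) = X + C (-1) := by simp [sub_eq_add_neg]
  rw [h, coeff_X_add_C_pow]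
  split_ifs with hj
  · congr 1
    obtain ⟨i, rfl⟩ := Nat.exists_eq_add_of_le hj
    -- The binomial theorem gives the sign `(-1)^(k - j)`, which has the same parity as `(-1)^(k +
    -- j)`.
    rw [Nat.add_sub_cancel_left, show j + i + j = i + 2 * j by ring, pow_add (-1 : ℤ) i, pow_mul]
    simp
  · rw [Nat.choose_eq_zero_of_lt (not_le.1 hj), Nat.cast_zero, mul_zero]

theorem coeff_facePolynomial (f : ℕ → ℕ) (n j : ℕ) :
    (facePolynomial f n).coeff j =
      ∑ k ∈ Finset.Icc j n, (f (n - k) : ℤ) * (-1) ^ (k + j) * (k.choose j : ℤ) := by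
  -- Reflecting `k` to `n - k` turns the terms into `f (n - k) * (X - 1) ^ k`.
  rw [facePolynomial, ← Finset.sum_range_reflect, finsetSum_coeff]
  have h : Finset.Icc j n = (Finset.range (n + 1)).filter (j ≤ ·) := by
    ext k; simp; omega
  rw [h, Finset.sum_filter]
  refine Finset.sum_congr rfl fun k hk => ?_
  have hk := Finset.mem_range.1 hk
  rw [coeff_C_mul, coeff_X_sub_one_pow, show n + 1 - 1 - k = n - k by omega,
    show n - (n - k) = k by omega, mul_ite, mul_zero, mul_assoc]

end FacePolynomial

/-- The zeta polynomial of a toric scheme. -/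
theorem Fan.isZetaPolynomial_toricScheme {N : Type u} [AddCommGroup N] [Module.Free ℤ N]
    [Module.Finite ℤ N] (Δ : Fan N) :
    IsZetaPolynomial (Δ.toricScheme ℤ) (facePolynomial Δ.numCones (Module.finrank ℤ N)) := by
  -- The count holds over every finite field, so `e = 1` works.
  refine ⟨1, one_pos, fun K _ _ _ => ?_⟩
  obtain ⟨hfin, hcard⟩ := card_points (K := K) Δ
  refine ⟨hfin, ?_⟩
  rw [hcard, facePolynomial, Polynomial.eval_finsetSum]
  push_cast [Nat.cast_sub (Nat.card_pos (α := K) : 1 ≤ Nat.card K)]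
  simp

end ToricF1

theorem proposition4p3 {N : Type*} [AddCommGroup N] [Module.Free ℤ N] [Module.Finite ℤ N]
    (n : ℕ) (hn : Module.finrank ℤ N = n) (Δ : ToricF1.Fan N)
    (f : ℕ → ℕ) (hf : ∀ j, f j = Δ.numCones j)
    (c : ℕ → ℤ) (hc : ∀ j, c j =
      ∑ k ∈ Finset.Icc j n, (f (n - k) : ℤ) * (-1) ^ (k + j) * (k.choose j : ℤ)) :
    (∀ P : Polynomial ℤ, ToricF1.IsZetaPolynomial (Δ.toricScheme ℤ) P ↔
      P = ∑ k ∈ Finset.range (n + 1),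
        Polynomial.C (f k : ℤ) * (Polynomial.X - 1) ^ (n - k)) ∧
    ToricF1.f1Zeta (Δ.toricScheme ℤ) =
      ∏ j ∈ Finset.range (n + 1), (RatFunc.X - RatFunc.C (j : ℂ)) ^ c j := by
  subst hn
  obtain rfl : f = Δ.numCones := funext hf
  have h := Δ.isZetaPolynomial_toricScheme
  refine ⟨fun P => ⟨fun hP => hP.unique h, fun hP => hP ▸ h⟩, ?_⟩
  rw [h.f1Zeta_eq, ToricF1.zetaOfPolynomial_eq_prod (ToricF1.natDegree_facePolynomial_le _ _)]
  refine Finset.prod_congr rfl fun j _ => ?_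
  rw [hc, ToricF1.coeff_facePolynomial]
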